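/- Let $\ell^2(\mathbb Z)$ have position basis $(e_x)_{x\in\mathbb Z}$ and translation $Se_x=e_{x+1}$, and let $\mathrm{HS}(\ell^2(\mathbb Z))$ be the Hilbert space of Hilbert–Schmidt operators on $\ell^2(\mathbb Z)$ with inner product $\langle\rho,\sigma\rangle=\operatorname{tr}(\rho^*\sigma)$. There is an isometric isomorphism $$\mathcal J:\mathrm{HS}(\ell^2(\mathbb Z))\to\int^{\oplus}_{[0,2\pi]}\ell^2(\mathbb Z)\,dq=L^2([0,2\pi];\ell^2(\mathbb Z)),\qquad \mathcal J\big(|e_x\rangle\langle e_y|\big)(q)=\tfrac1{\sqrt{2\pi}}\,e^{-iqx}\,e_{y-x}\quad\text{for a.e. }q,$$ such that the following holds for all integers $R,N\ge 0$, every $G>0$, and all bounded operators $H$ and $L_{j,k}$ ($1\le j\le N$, $k\in\mathbb Z$) on $\ell^2(\mathbb Z)$ such that - $H=H^*$, $\langle e_x,He_y\rangle=0$ whenever $|x-y|>R$, and $SHS^{-1}=H$; - $\langle e_x,L_{j,k}e_y\rangle=0$ whenever $|x-k|>R$ or $|y-k|>R$, and $L_{j,k+1}=SL_{j,k}S^{-1}$,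 for all $j,k$. For every $\rho\in\mathrm{HS}(\ell^2(\mathbb Z))$ the series $$\mathcal L(\rho)=-i[H,\rho]+G\sum_{j,k}\Big(L_{j,k}\rho L_{j,k}^*-\tfrac12\big(L_{j,k}^*L_{j,k}\rho+\rho L_{j,k}^*L_{j,k}\big)\Big)$$ converges unconditionally in Hilbert–Schmidt norm and defines a bounded operator $\mathcal L$ on $\mathrm{HS}(\ell^2(\mathbb Z))$, and there are measurable, essentially bounded families $T(q)$ and $F(q)$ of bounded operators on $\ell^2(\mathbb Z)$ with $$\mathcal J\mathcal L\mathcal J^*=\int^{\oplus}_{[0,2\pi]}\big(T(q)+F(q)\big)\,dq,$$ that is, $(\mathcal J\mathcal L\mathcal J^*\psi)(q)=(T(q)+F(q))\psi(q)$ for a.e. $q$, for every $\psi$. For every $q\in[0,2\pi]$, $T(q)$ is a bi-infinite $(4R+1)$-diagonal Laurent operator: $\langle e_n,T(q)e_m\rangle$ depends only on $n-m$ and vanishes for $|n-m|>2R$. For every $q\in[0,2\pi]$, $F(q)$ has finite rank and finite range: $\langle e_n,F(q)e_m\rangle=0$ if $|n|>2R$ or $|m|>2R$ (so in particular if $|n-m|>4R$).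 -/

import Mathlib

open scoped ENNReal
open MeasureTheory

noncomputable section

namespace OpenQuantum

/-- The single-particle Hilbert space `ℓ²(ℤ)`. -/
abbrev Space : Type := lp (fun _ : ℤ => ℂ) 2

/-- The position basis vector `e_x`. -/
def pos (x : ℤ) : Space := lp.single 2 x (1 : ℂ)

/-- The matrix element `⟨e_x, A e_y⟩`. -/
def entry (A : Space →L[ℂ] Space) (x y : ℤ) : ℂ := inner ℂ (pos x) (A (pos y))

theorem inner_pos_left (x : ℤ) (v : Space) : inner ℂ (pos x) v = v x := by
  simp [pos, lp.inner_single_left]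

theorem norm_pos (x : ℤ) : ‖pos x‖ = 1 := by
  simp [pos, lp.norm_single]

theorem hasSum_norm_sq (v : Space) : HasSum (fun x => ‖v x‖ ^ 2) (‖v‖ ^ 2) := by
  have h := lp.hasSum_norm (p := 2) (by norm_num) v
  simpa using h

/-! ### The translation by one lattice site -/

theorem memℓp_comp_sub (v : Space) (k : ℤ) : Memℓp (fun x : ℤ => v (x - k)) 2 := by
  have h : Summable fun x : ℤ => ‖v x‖ ^ (2 : ℝ≥0∞).toReal :=
    (lp.memℓp v).summable (by norm_num)
  exact memℓp_gen ((Equiv.subRight k).summable_iff.mpr h)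

/-- Translation by `k` sites: `(S_k v)(x) = v (x - k)`. -/
def shift (k : ℤ) : Space →ₗᵢ[ℂ] Space where
  toFun v := ⟨fun x => v (x - k), memℓp_comp_sub v k⟩
  map_add' _ _ := rfl
  map_smul' _ _ := rfl
  norm_map' v := by
    have h1 := hasSum_norm_sq (⟨fun x => v (x - k), memℓp_comp_sub v k⟩ : Space)
    have h2 := (Equiv.subRight k).hasSum_iff.mpr (hasSum_norm_sq v)
    have h3 := h1.unique h2
    exact (sq_eq_sq₀ (norm_nonneg _) (norm_nonneg _)).mp h3

theorem shift_apply (k : ℤ) (v : Space) (x : ℤ) : shift k v x = v (x - k) := rfl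

/-- The conjugate `S A S⁻¹` of an operator by the translation `S` by one site. -/
def conjShift (A : Space →L[ℂ] Space) : Space →L[ℂ] Space :=
  (shift 1).toContinuousLinearMap ∘L A ∘L (shift (-1)).toContinuousLinearMap

/-! ### Hilbert–Schmidt operators on `ℓ²(ℤ)` -/

/-- `A` is Hilbert–Schmidt: `∑_y ‖A e_y‖² < ∞`. -/
def IsHS (A : Space →L[ℂ] Space) : Prop := Summable fun y : ℤ => ‖A (pos y)‖ ^ 2

theorem IsHS.memℓp {A : Space →L[ℂ] Space} (hA : IsHS A) :
    Memℓp (fun y : ℤ => A (pos y)) 2 := by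
  refine memℓp_gen ?_
  have h : Summable fun y : ℤ => ‖A (pos y)‖ ^ 2 := hA
  simpa using h

theorem isHS_of_memℓp {A : Space →L[ℂ] Space} (hA : Memℓp (fun y : ℤ => A (pos y)) 2) :
    IsHS A := by
  have h := hA.summable (by norm_num)
  change Summable fun y : ℤ => ‖A (pos y)‖ ^ 2
  simpa using h

theorem entry_eq (A : Space →L[ℂ] Space) (x y : ℤ) : entry A x y = A (pos y) x :=
  inner_pos_left x _

theorem entry_adjoint (A : Space →L[ℂ] Space) (x y : ℤ) :
    entry (star A) x y = star (entry A y x) := by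
  simp [entry, ContinuousLinearMap.star_eq_adjoint, ContinuousLinearMap.adjoint_inner_right]

theorem IsHS.adjoint {A : Space →L[ℂ] Space} (hA : IsHS A) : IsHS (star A) := by
  have key : ∀ (B : Space →L[ℂ] Space) (y : ℤ),
      HasSum (fun x => ‖entry B x y‖ ^ 2) (‖B (pos y)‖ ^ 2) := by
    intro B y
    simpa only [entry_eq] using hasSum_norm_sq (B (pos y))
  have h : Summable fun p : ℤ × ℤ => ‖entry A p.2 p.1‖ ^ 2 := by
    rw [summable_prod_of_nonneg (fun p => by positivity)]
    refine ⟨fun y => (key A y).summable, ?_⟩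
    simp only [(key A _).tsum_eq]
    exact hA
  have h2 : Summable fun p : ℤ × ℤ => ‖entry A p.1 p.2‖ ^ 2 := h.prod_symm
  rw [summable_prod_of_nonneg (fun p => by positivity)] at h2
  have h3 := h2.2
  refine h3.congr fun x => ?_
  rw [← (key (star A) x).tsum_eq]
  refine tsum_congr fun y => ?_
  rw [entry_adjoint, norm_star]

theorem IsHS.comp_left {A : Space →L[ℂ] Space} (hA : IsHS A) (B : Space →L[ℂ] Space) :
    IsHS (B * A) := by
  refine Summable.of_nonneg_of_le (fun y => by positivity) (fun y => ?_)
    (Summable.mul_left (‖B‖ ^ 2) hA)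
  rw [← mul_pow]
  exact pow_le_pow_left₀ (norm_nonneg _) (B.le_opNorm _) 2

theorem IsHS.comp_right {A : Space →L[ℂ] Space} (hA : IsHS A) (B : Space →L[ℂ] Space) :
    IsHS (A * B) := by
  have h := (hA.adjoint.comp_left (star B)).adjoint
  simpa using h

/-- The Hilbert–Schmidt operators as a linear subspace of the bounded operators. -/
def hsSubmodule : Submodule ℂ (Space →L[ℂ] Space) where
  carrier := {A | IsHS A}
  zero_mem' := by simp [IsHS, summable_zero]
  add_mem' hA hB := isHS_of_memℓp (IsHS.memℓp hA |>.add (IsHS.memℓp hB))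
  smul_mem' c _ hA := isHS_of_memℓp ((IsHS.memℓp hA).const_smul c)

/-- The space `HS(ℓ²(ℤ))`. It is a type of its own, because it carries the Hilbert–Schmidt norm and
not the operator norm. -/
def HS : Type := hsSubmodule

namespace HS

instance : AddCommGroup HS := inferInstanceAs (AddCommGroup hsSubmodule)

instance : Module ℂ HS := inferInstanceAs (Module ℂ hsSubmodule)

/-- The underlying bounded operator. -/
def op (ρ : HS) : Space →L[ℂ] Space := ρ.1

/-- A bounded operator that is Hilbert–Schmidt, as an element of `HS`. -/
def mk (A : Space →L[ℂ] Space) (hA : IsHS A) : HS := ⟨A, hA⟩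

/-- The columns `y ↦ ρ e_y` of a Hilbert–Schmidt operator, as an element of `ℓ²(ℤ; ℓ²(ℤ))`. -/
def columns : HS →ₗ[ℂ] lp (fun _ : ℤ => Space) 2 where
  toFun ρ := ⟨fun y => ρ.op (pos y), IsHS.memℓp ρ.2⟩
  map_add' _ _ := rfl
  map_smul' _ _ := rfl

theorem op_injective : Function.Injective op := Subtype.val_injective

theorem columns_injective : Function.Injective columns := by
  intro ρ σ h
  apply op_injective
  have hcol : ∀ y, ρ.op (pos y) = σ.op (pos y) := fun y => congrFun (congrArg Subtype.val h) y
  have hent : ∀ (v : Space), ρ.op v = σ.op v := by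
    intro v
    have hv := lp.hasSum_single (p := 2) (by norm_num) v
    have e : ∀ y, ρ.op (lp.single 2 y (v y)) = σ.op (lp.single 2 y (v y)) := by
      intro y
      have : (lp.single 2 y (v y) : Space) = v y • pos y := by
        rw [pos, ← lp.single_smul]; simp
      rw [this, map_smul, map_smul, hcol]
    have h1 := hv.mapL ρ.op
    have h2 := hv.mapL σ.op
    simp only [e] at h1
    exact h1.unique h2
  exact ContinuousLinearMap.ext hent

/-- The Hilbert–Schmidt norm, `‖ρ‖² = ∑_y ‖ρ e_y‖²`. -/
instance : NormedAddCommGroup HS :=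
  NormedAddCommGroup.induced HS (lp (fun _ : ℤ => Space) 2) columns columns_injective

/-- The Hilbert–Schmidt inner product, `⟨ρ, σ⟩ = ∑_y ⟨ρ e_y, σ e_y⟩ = tr (ρ* σ)`. -/
instance : InnerProductSpace ℂ HS where
  toNormedSpace := NormedSpace.induced ℂ HS (lp (fun _ : ℤ => Space) 2) columns
  inner ρ σ := inner ℂ (columns ρ) (columns σ)
  norm_sq_eq_re_inner ρ := norm_sq_eq_re_inner (𝕜 := ℂ) (columns ρ)
  conj_inner_symm ρ σ := inner_conj_symm (𝕜 := ℂ) (columns ρ) (columns σ)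
  add_left ρ σ τ := by rw [map_add, inner_add_left]
  smul_left ρ σ c := by rw [map_smul, inner_smul_left]

theorem inner_eq (ρ σ : HS) : inner ℂ ρ σ = ∑' y, inner ℂ (ρ.op (pos y)) (σ.op (pos y)) := rfl

/-- The product `B ρ`. -/
def lmul (B : Space →L[ℂ] Space) (ρ : HS) : HS := mk (B * ρ.op) (IsHS.comp_left ρ.2 B)

/-- The product `ρ B`. -/
def rmul (ρ : HS) (B : Space →L[ℂ] Space) : HS := mk (ρ.op * B) (IsHS.comp_right ρ.2 B)

theorem isHS_rankOne (x y : ℤ) : IsHS (InnerProductSpace.rankOne ℂ (pos x) (pos y)) := by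
  refine summable_of_ne_finset_zero (s := {y}) fun z hz => ?_
  have hz' : z ≠ y := by simpa using hz
  have : inner ℂ (pos y) (pos z) = 0 := by
    rw [inner_pos_left, pos, lp.single_apply_ne _ _ _ hz'.symm]
  simp [this]

/-- The matrix unit `|e_x⟩⟨e_y|`. -/
def unit (x y : ℤ) : HS := mk (InnerProductSpace.rankOne ℂ (pos x) (pos y)) (isHS_rankOne x y)

end HS

/-! ### Lindblad generators -/

/-- The dissipator `L ρ L* - ½ (L* L ρ + ρ L* L)` of one Lindblad operator. -/
def dissipator (L : Space →L[ℂ] Space) (ρ : HS) : HS :=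
  ((ρ.lmul L).rmul (star L)) - (1 / 2 : ℂ) • (ρ.lmul (star L * L) + ρ.rmul (star L * L))

/-- `𝓛` is the Lindblad generator on `HS(ℓ²(ℤ))` with Hamiltonian `H`, dissipation strength `G` and
Lindblad operators `L i` (`i ∈ κ`):
`𝓛 ρ = -i [H, ρ] + G ∑_i (L_i ρ L_i* - ½ (L_i* L_i ρ + ρ L_i* L_i))` for every `ρ`, the sum
converging unconditionally in Hilbert–Schmidt norm. -/
def IsLindbladian {κ : Type*} (H : Space →L[ℂ] Space) (G : ℝ) (L : κ → Space →L[ℂ] Space)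
    (𝓛 : HS →L[ℂ] HS) : Prop :=
  ∀ ρ : HS, ∃ D : HS, HasSum (fun i => dissipator (L i) ρ) D ∧
    𝓛 ρ = -Complex.I • (ρ.lmul H - ρ.rmul H) + (G : ℂ) • D

/-- `A` has range at most `r`: its matrix elements vanish at distance more than `r` from the
diagonal, so only `2 r + 1` diagonals can be nonzero. -/
def HasRange (r : ℕ) (A : Space →L[ℂ] Space) : Prop :=
  ∀ x y : ℤ, (r : ℤ) < |x - y| → entry A x y = 0

/-- `A` acts only on the sites at distance at most `r` from `k`. -/
def IsLocalAt (k : ℤ) (r : ℕ) (A : Space →L[ℂ] Space) : Prop :=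
  ∀ x y : ℤ, (r : ℤ) < |x - k| ∨ (r : ℤ) < |y - k| → entry A x y = 0

/-- The standing assumptions on the Hamiltonian `H` and on the Lindblad operators `L j k`, with
`k ∈ ℤ` the site and `j` one of `N` species: `H` is self-adjoint, everything is local with
radius `R`, and everything is translation invariant. -/
structure IsLocalTranslationInvariant (R N : ℕ) (H : Space →L[ℂ] Space)
    (L : Fin N × ℤ → Space →L[ℂ] Space) : Prop where
  selfAdjoint : IsSelfAdjoint H
  hamiltonian_range : HasRange R H
  hamiltonian_translation : conjShift H = H
  lindblad_local : ∀ (j : Fin N) (k : ℤ), IsLocalAt k R (L (j, k))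
  lindblad_translation : ∀ (j : Fin N) (k : ℤ), L (j, k + 1) = conjShift (L (j, k))

/-! ### Direct integrals with constant fibre -/

/-- Lebesgue measure on `[0, 2π]`. -/
abbrev circleMeasure : Measure ℝ := volume.restrict (Set.Icc 0 (2 * Real.pi))

/-- The direct integral `∫^⊕_{[0, 2π]} ℓ²(ℤ) dq`: as the fibre is constant, this is the space of
square-integrable functions on `[0, 2π]` with values in `ℓ²(ℤ)`. -/
abbrev DirectIntegral : Type := Lp Space 2 circleMeasure

/-- `q ↦ a q` is a (weakly) measurable, essentially bounded family of operators on the fibres. -/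
structure IsBoundedField (a : ℝ → Space →L[ℂ] Space) : Prop where
  measurable : ∀ v w : Space, Measurable fun q => inner ℂ v (a q w)
  bounded : ∃ C : ℝ, ∀ᵐ q ∂circleMeasure, ‖a q‖ ≤ C

/-- `A = ∫^⊕_{[0, 2π]} a(q) dq`. -/
structure IsDirectIntegral (A : DirectIntegral →L[ℂ] DirectIntegral)
    (a : ℝ → Space →L[ℂ] Space) : Prop where
  field : IsBoundedField a
  apply_ae : ∀ ψ : DirectIntegral, ∀ᵐ q ∂circleMeasure, A ψ q = a q (ψ q)

/-- A bi-infinite Laurent operator: `⟨e_x, T e_y⟩` depends only on `x - y`. -/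
def IsLaurent (T : Space →L[ℂ] Space) : Prop :=
  ∃ t : ℤ → ℂ, ∀ x y : ℤ, entry T x y = t (x - y)

/-- `F` has finite rank. -/
def IsFiniteRank (F : Space →L[ℂ] Space) : Prop :=
  FiniteDimensional ℂ (LinearMap.range F.toLinearMap)

/-- `J` is the Fourier transform in the position at fixed relative coordinate,
`(J ρ)(q)(n) = (2π)^{-1/2} ∑_x e^{-iqx} ⟨e_x, ρ e_{x+n}⟩`. This is stated on the matrix units
`|e_x⟩⟨e_y|`, whose span is dense: they are sent to `q ↦ (2π)^{-1/2} e^{-iqx} e_{y-x}`. -/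
def IsFourierIsomorphism (J : HS ≃ₗᵢ[ℂ] DirectIntegral) : Prop :=
  ∀ x y : ℤ, ∀ᵐ q ∂circleMeasure,
    J (HS.unit x y) q =
      (((Real.sqrt (2 * Real.pi) : ℝ) : ℂ)⁻¹ * Complex.exp (-Complex.I * q * x)) • pos (y - x)

/-- The conjugate `J 𝓛 J*` of an operator by a unitary `J`. -/
def conjugate (J : HS ≃ₗᵢ[ℂ] DirectIntegral) (𝓛 : HS →L[ℂ] HS) :
    DirectIntegral →L[ℂ] DirectIntegral :=
  J.toContinuousLinearEquiv.toContinuousLinearMap ∘L 𝓛 ∘L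
    J.symm.toContinuousLinearEquiv.toContinuousLinearMap

end OpenQuantum

end

noncomputable section

namespace OpenQuantum

/-! Label the matrix unit `|e_x⟩⟨e_y|` by its position `x` and its relative coordinate `n = y - x`.
The generator commutes with simultaneous translation of `x` and `y`, so the Fourier transform in `x`
at fixed `n` turns it into a family of operators on the `n`-line, and it remains to see what each
building block becomes.

Left multiplication by `S^s` sends `(x, n)` to `(x + s, n - s)`, hence has fibre `e^{-iqs} S^{-s}`;
right multiplication by `S^s` fixes `x` and has fibre `S^{-s}` (`decomposes_lmulL_shiftL`,
`decomposes_rmulL_shiftL`). The Hamiltonian is a Laurent polynomial in `S`, and summing the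
anticommutators with `L_k* L_k` over the sites `k` also leaves only multiplications by powers of
`S`. These parts form `T(q)`.

Expanding the jump terms in matrix units gives the maps `ρ ↦ ∑_k |e_{k+a}⟩⟨e_{k+b}| ρ
|e_{k+d}⟩⟨e_{k+c}|`. Such a map sees only the relative coordinate `d - b` and returns only `c - a`,
so its fibre is the rank-one operator `e^{-iq(a-b)} |e_{c-a}⟩⟨e_{d-b}|` (`decomposes_transfer`). The
offsets lie in `[-R, R]` and their differences in `[-2R, 2R]`; this is `F(q)`.

The site sums converge for each fixed `ρ`, because they reduce to summing its columns, its rows, or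
its diagonal (`IsCovariantFamily.hasSum_dissipator`). -/

/-! ### Position basis, translations and rank-one operators. -/

theorem pos_apply (x y : ℤ) : pos x y = if y = x then 1 else 0 := by
  split_ifs with h
  · subst h; simp [pos]
  · rw [pos, lp.single_apply_ne _ _ _ h]

theorem inner_pos_pos (x y : ℤ) : inner ℂ (pos x) (pos y) = if x = y then (1 : ℂ) else 0 := by
  rw [inner_pos_left, pos_apply]

theorem lp_single_eq (y : ℤ) (c : ℂ) : (lp.single 2 y c : Space) = c • pos y := by
  rw [pos, ← lp.single_smul]; simp

theorem hasSum_pos (v : Space) : HasSum (fun y => v y • pos y) v := by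
  simpa only [lp_single_eq] using lp.hasSum_single (p := 2) (by norm_num) v

theorem ext_pos {A B : Space →L[ℂ] Space} (h : ∀ y, A (pos y) = B (pos y)) : A = B := by
  ext1 v
  have h1 := (hasSum_pos v).mapL A
  have h2 := (hasSum_pos v).mapL B
  simp only [map_smul, h] at h1 h2
  exact h1.unique h2

theorem ext_entry {A B : Space →L[ℂ] Space} (h : ∀ x y, entry A x y = entry B x y) : A = B :=
  ext_pos fun y => lp.ext (funext fun x => by simpa only [entry_eq] using h x y)

theorem shift_pos (k x : ℤ) : shift k (pos x) = pos (x + k) := by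
  ext z
  rw [shift_apply, pos_apply, pos_apply]
  simp only [sub_eq_iff_eq_add]

/-- Translation by `k` sites as a bounded operator. -/
def shiftL (k : ℤ) : Space →L[ℂ] Space := (shift k).toContinuousLinearMap

theorem shiftL_pos (k x : ℤ) : shiftL k (pos x) = pos (x + k) := shift_pos k x

theorem shiftL_mul (k l : ℤ) : shiftL k * shiftL l = shiftL (k + l) :=
  ext_pos fun y => by
    simp only [mul_apply_eq_comp, shiftL_pos]
    congr 1; ring

theorem entry_shiftL (k x y : ℤ) : entry (shiftL k) x y = if x = y + k then 1 else 0 := by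
  rw [entry, shiftL_pos, inner_pos_pos]

/-- The rank-one operator `|e_x⟩⟨e_y|`. -/
def ketBra (x y : ℤ) : Space →L[ℂ] Space := InnerProductSpace.rankOne ℂ (pos x) (pos y)

theorem ketBra_apply (x y : ℤ) (v : Space) : ketBra x y v = v y • pos x := by
  rw [ketBra, InnerProductSpace.rankOne_apply, inner_pos_left]

theorem ketBra_pos (x y z : ℤ) : ketBra x y (pos z) = if y = z then pos x else 0 := by
  rw [ketBra_apply, pos_apply]
  split_ifs <;> simp

theorem entry_ketBra (a b x y : ℤ) :
    entry (ketBra a b) x y = if x = a ∧ y = b then 1 else 0 := by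
  rw [entry, ketBra_pos]
  by_cases h : b = y
  · rw [if_pos h, inner_pos_pos]; simp [h]
  · rw [if_neg h, inner_zero_right, if_neg (fun h' => h h'.2.symm)]

theorem shiftL_mul_ketBra_mul_shiftL (a b x y : ℤ) :
    shiftL a * ketBra x y * shiftL b = ketBra (x + a) (y - b) :=
  ext_pos fun z => by
    simp only [mul_apply_eq_comp, shiftL_pos, ketBra_pos, sub_eq_iff_eq_add]
    split_ifs <;> simp [shiftL_pos]

theorem star_ketBra (x y : ℤ) : star (ketBra x y) = ketBra y x :=
  ext_entry fun a b => by
    rw [entry_adjoint, entry_ketBra, entry_ketBra]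
    simp only [and_comm]
    split_ifs <;> simp

theorem entry_add (A B : Space →L[ℂ] Space) (x y : ℤ) :
    entry (A + B) x y = entry A x y + entry B x y := by
  simp [entry_eq]

theorem entry_smul (c : ℂ) (A : Space →L[ℂ] Space) (x y : ℤ) :
    entry (c • A) x y = c * entry A x y := by
  simp [entry_eq]

theorem entry_sum {ι : Type*} (s : Finset ι) (A : ι → Space →L[ℂ] Space) (x y : ℤ) :
    entry (∑ i ∈ s, A i) x y = ∑ i ∈ s, entry (A i) x y := by
  simp only [entry, sum_apply, inner_sum]

/-! ### The Hilbert space of Hilbert–Schmidt operators and its matrix units. -/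

namespace HS

@[simp] theorem op_add (ρ σ : HS) : (ρ + σ).op = ρ.op + σ.op := rfl

@[simp] theorem op_smul (c : ℂ) (ρ : HS) : (c • ρ).op = c • ρ.op := rfl

@[simp] theorem op_zero : (0 : HS).op = 0 := rfl

@[simp] theorem op_lmul (B : Space →L[ℂ] Space) (ρ : HS) : (ρ.lmul B).op = B * ρ.op := rfl

@[simp] theorem op_rmul (B : Space →L[ℂ] Space) (ρ : HS) : (ρ.rmul B).op = ρ.op * B := rfl

theorem op_unit (x y : ℤ) : (unit x y).op = ketBra x y := rfl

theorem norm_columns (ρ : HS) : ‖columns ρ‖ = ‖ρ‖ := rfl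

theorem hasSum_norm_sq_columns (c : lp (fun _ : ℤ => Space) 2) :
    HasSum (fun y => ‖c y‖ ^ 2) (‖c‖ ^ 2) := by
  simpa using lp.hasSum_norm (p := 2) (by norm_num) c

theorem hasSum_norm_sq (ρ : HS) : HasSum (fun y => ‖ρ.op (pos y)‖ ^ 2) (‖ρ‖ ^ 2) :=
  hasSum_norm_sq_columns (columns ρ)

/-- Cauchy–Schwarz between the column norms and the coefficients of `v`; it makes `ofColumns` a
bounded operator, whence `columns` is onto. -/
theorem summable_smul_columns (c : lp (fun _ : ℤ => Space) 2) (v : Space) :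
    Summable (fun y => v y • c y) ∧ ‖∑' y, v y • c y‖ ≤ ‖c‖ * ‖v‖ := by
  have h := Real.inner_le_Lp_mul_Lq_hasSum_of_nonneg (p := 2) (q := 2)
    (f := fun y => ‖c y‖) (g := fun y => ‖v y‖) (A := ‖c‖) (B := ‖v‖)
    Real.HolderConjugate.two_two (norm_nonneg _) (norm_nonneg _)
    (fun _ => norm_nonneg _) (fun _ => norm_nonneg _)
    (by simpa using hasSum_norm_sq_columns c) (by simpa using OpenQuantum.hasSum_norm_sq v)
  obtain ⟨C, hC0, hC, hs⟩ := h
  have hs' : HasSum (fun y => ‖v y • c y‖) C := by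
    simpa only [norm_smul, mul_comm] using hs
  exact ⟨hs'.summable.of_norm, (tsum_of_norm_bounded hs' fun _ => le_rfl).trans hC⟩

/-- The operator with prescribed square-summable columns. -/
def ofColumns (c : lp (fun _ : ℤ => Space) 2) : Space →L[ℂ] Space :=
  LinearMap.mkContinuous
    { toFun := fun v => ∑' y, v y • c y
      map_add' := fun v w => by
        rw [← (summable_smul_columns c v).1.tsum_add (summable_smul_columns c w).1]
        simp only [lp.coeFn_add, Pi.add_apply, add_smul]
      map_smul' := fun a v => by
        rw [RingHom.id_apply, ← (summable_smul_columns c v).1.tsum_const_smul]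
        simp only [lp.coeFn_smul, Pi.smul_apply, smul_assoc] }
    ‖c‖ fun v => (summable_smul_columns c v).2

theorem ofColumns_pos (c : lp (fun _ : ℤ => Space) 2) (y : ℤ) : ofColumns c (pos y) = c y := by
  change ∑' z, pos y z • c z = c y
  rw [tsum_eq_single y fun z hz => by rw [pos_apply, if_neg hz, zero_smul], pos_apply, if_pos rfl,
    one_smul]

/-- Hilbert–Schmidt operators are the same as square-summable families of columns. -/
def columnsEquiv : HS ≃ₗᵢ[ℂ] lp (fun _ : ℤ => Space) 2 :=
  LinearIsometryEquiv.ofSurjective { columns with norm_map' := norm_columns } fun c => by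
    refine ⟨mk (ofColumns c) ?_, ?_⟩
    · simpa only [IsHS, ofColumns_pos] using (hasSum_norm_sq_columns c).summable
    · exact lp.ext (funext fun y => ofColumns_pos c y)

theorem columnsEquiv_apply (ρ : HS) (y : ℤ) : columnsEquiv ρ y = ρ.op (pos y) := rfl

theorem columnsEquiv_symm_op_pos (c : lp (fun _ : ℤ => Space) 2) (y : ℤ) :
    (columnsEquiv.symm c).op (pos y) = c y := by
  rw [← columnsEquiv_apply, LinearIsometryEquiv.apply_symm_apply]

instance : CompleteSpace HS :=
  (completeSpace_congr (e := columnsEquiv.toEquiv) columnsEquiv.isometry.isUniformEmbedding).mpr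
    inferInstance

theorem ext_op_pos {ρ σ : HS} (h : ∀ y, ρ.op (pos y) = σ.op (pos y)) : ρ = σ :=
  op_injective (ext_pos h)

theorem inner_unit (x y : ℤ) (ρ : HS) : inner ℂ (unit x y) ρ = entry ρ.op x y := by
  rw [inner_eq, tsum_eq_single y, op_unit, ketBra_pos, if_pos rfl, entry]
  intro z hz
  rw [op_unit, ketBra_pos, if_neg hz.symm, inner_zero_left]

theorem orthonormal_unit : Orthonormal ℂ fun p : ℤ × ℤ => unit p.1 p.2 := by
  rw [orthonormal_iff_ite]
  rintro ⟨x, y⟩ ⟨x', y'⟩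
  rw [inner_unit, op_unit, entry_ketBra]
  simp only [Prod.mk.injEq]

/-- The matrix units form a Hilbert basis. -/
def unitBasis : HilbertBasis (ℤ × ℤ) ℂ HS :=
  HilbertBasis.mkOfOrthogonalEqBot orthonormal_unit <| by
    refine (Submodule.eq_bot_iff _).mpr fun ρ hρ => op_injective (ext_entry fun x y => ?_)
    rw [← inner_unit]
    rw [(Submodule.mem_orthogonal _ _).mp hρ _ (Submodule.subset_span ⟨(x, y), rfl⟩)]
    simp [entry_eq]

theorem unitBasis_apply (p : ℤ × ℤ) : unitBasis p = unit p.1 p.2 := by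
  simp [unitBasis]

/-- Parseval for the matrix units. Unlike the definition of the norm by columns, this form is
symmetric in rows and columns, which makes the adjoint isometric. -/
theorem hasSum_norm_sq_entry (ρ : HS) :
    HasSum (fun p : ℤ × ℤ => ‖entry ρ.op p.1 p.2‖ ^ 2) (‖ρ‖ ^ 2) := by
  have h := lp.hasSum_norm (p := 2) (by norm_num) (unitBasis.repr ρ)
  simpa [HilbertBasis.repr_apply_apply, unitBasis_apply, inner_unit] using h

/-- The adjoint of a Hilbert–Schmidt operator. -/
def adj (ρ : HS) : HS := mk (star ρ.op) (IsHS.adjoint ρ.2)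

theorem op_adj (ρ : HS) : (adj ρ).op = star ρ.op := rfl

theorem adj_adj (ρ : HS) : adj (adj ρ) = ρ := op_injective (star_star _)

theorem norm_adj (ρ : HS) : ‖adj ρ‖ = ‖ρ‖ := by
  have h1 := (Equiv.prodComm ℤ ℤ).hasSum_iff.mpr (hasSum_norm_sq_entry (adj ρ))
  have h2 : (fun p : ℤ × ℤ => ‖entry (adj ρ).op p.1 p.2‖ ^ 2) ∘ Equiv.prodComm ℤ ℤ =
      fun p : ℤ × ℤ => ‖entry ρ.op p.1 p.2‖ ^ 2 := by
    funext p
    simp [op_adj, entry_adjoint]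
  rw [h2] at h1
  exact (sq_eq_sq₀ (norm_nonneg _) (norm_nonneg _)).mp (h1.unique (hasSum_norm_sq_entry ρ))

/-- The adjoint as an additive map. -/
def adjHom : HS →+ HS where
  toFun := adj
  map_zero' := op_injective (star_zero _)
  map_add' ρ σ := op_injective (star_add ρ.op σ.op)

theorem continuous_adj : Continuous adj :=
  AddMonoidHomClass.continuous_of_bound adjHom 1 fun ρ => by
    rw [one_mul]; exact (norm_adj ρ).le

theorem norm_lmul_le (B : Space →L[ℂ] Space) (ρ : HS) : ‖ρ.lmul B‖ ≤ ‖B‖ * ‖ρ‖ := by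
  refine (sq_le_sq₀ (norm_nonneg _) (by positivity)).mp ?_
  rw [mul_pow]
  refine hasSum_le (fun y => ?_) (hasSum_norm_sq (ρ.lmul B)) ((hasSum_norm_sq ρ).mul_left _)
  rw [← mul_pow]
  exact pow_le_pow_left₀ (norm_nonneg _) (B.le_opNorm _) 2

/-- Reduces the bound for right multiplication to the bound for left multiplication, as `adj` is
isometric. -/
theorem rmul_eq (B : Space →L[ℂ] Space) (ρ : HS) :
    ρ.rmul B = adj ((adj ρ).lmul (star B)) := by
  apply op_injective
  simp [op_adj]

/-- Left multiplication by a bounded operator. -/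
def lmulL : (Space →L[ℂ] Space) →ₗ[ℂ] HS →L[ℂ] HS where
  toFun B := LinearMap.mkContinuous
    { toFun := lmul B
      map_add' := fun ρ σ => op_injective (mul_add B ρ.op σ.op)
      map_smul' := fun c ρ => op_injective (mul_smul_comm c B ρ.op) } ‖B‖ (norm_lmul_le B)
  map_add' A B := ContinuousLinearMap.ext fun ρ => op_injective (add_mul A B ρ.op)
  map_smul' c B := ContinuousLinearMap.ext fun ρ => op_injective (smul_mul_assoc c B ρ.op)

theorem lmulL_apply (B : Space →L[ℂ] Space) (ρ : HS) : lmulL B ρ = ρ.lmul B := rfl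

/-- Right multiplication by a bounded operator. -/
def rmulL : (Space →L[ℂ] Space) →ₗ[ℂ] HS →L[ℂ] HS where
  toFun B := LinearMap.mkContinuous
    { toFun := fun ρ => ρ.rmul B
      map_add' := fun ρ σ => op_injective (add_mul ρ.op σ.op B)
      map_smul' := fun c ρ => op_injective (smul_mul_assoc c ρ.op B) } ‖B‖ fun ρ => by
        have h := norm_lmul_le (star B) (adj ρ)
        rw [ContinuousLinearMap.star_eq_adjoint, LinearIsometryEquiv.norm_map,
          ← ContinuousLinearMap.star_eq_adjoint, norm_adj, ← norm_adj, ← rmul_eq] at h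
        exact h
  map_add' A B := ContinuousLinearMap.ext fun ρ => op_injective (mul_add ρ.op A B)
  map_smul' c B := ContinuousLinearMap.ext fun ρ => op_injective (mul_smul_comm c ρ.op B)

theorem rmulL_apply (B : Space →L[ℂ] Space) (ρ : HS) : rmulL B ρ = ρ.rmul B := rfl

theorem lmulL_mul (A B : Space →L[ℂ] Space) (ρ : HS) :
    lmulL (A * B) ρ = lmulL A (lmulL B ρ) := op_injective (mul_assoc A B ρ.op)

theorem rmulL_mul (A B : Space →L[ℂ] Space) (ρ : HS) :
    rmulL (A * B) ρ = rmulL B (rmulL A ρ) := op_injective (mul_assoc ρ.op A B).symm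

theorem lmulL_rmulL (A B : Space →L[ℂ] Space) (ρ : HS) :
    lmulL A (rmulL B ρ) = rmulL B (lmulL A ρ) := op_injective (mul_assoc A ρ.op B).symm

theorem lmulL_shiftL_unit (s x y : ℤ) : lmulL (shiftL s) (unit x y) = unit (x + s) y :=
  ext_op_pos fun z => by
    simp only [lmulL_apply, op_lmul, op_unit, mul_apply_eq_comp, ketBra_pos]
    split_ifs <;> simp [shiftL_pos]

theorem rmulL_shiftL_unit (s x y : ℤ) : rmulL (shiftL s) (unit x y) = unit x (y - s) :=
  ext_op_pos fun z => by
    simp only [rmulL_apply, op_rmul, op_unit, mul_apply_eq_comp, ketBra_pos, shiftL_pos,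
      sub_eq_iff_eq_add]

/-! ### Sums over lattice sites. -/

/-- The diagonal part of a Hilbert–Schmidt operator in the position basis. -/
def diag : HS →L[ℂ] HS :=
  columnsEquiv.symm.toContinuousLinearEquiv.toContinuousLinearMap ∘L
    lp.mapCLM 2 (fun k : ℤ => ketBra k k) (K := 1) zero_le_one
      (fun k => by simp [ketBra, norm_pos]) ∘L
    columnsEquiv.toContinuousLinearEquiv.toContinuousLinearMap

theorem diag_op_pos (ρ : HS) (k : ℤ) : (diag ρ).op (pos k) = entry ρ.op k k • pos k := by
  refine (columnsEquiv_symm_op_pos _ k).trans ?_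
  rw [entry_eq, ← ketBra_apply]
  rfl

theorem diag_unit (x y : ℤ) : diag (unit x y) = if x = y then unit x y else 0 :=
  ext_op_pos fun z => by
    rw [diag_op_pos, op_unit, entry_ketBra]
    by_cases h : x = y
    · subst h
      rw [if_pos rfl, op_unit, ketBra_pos]
      by_cases hz : z = x
      · simp [hz]
      · simp [hz, Ne.symm hz]
    · have : ¬ (z = x ∧ z = y) := fun h' => h (h'.1.symm.trans h'.2)
      simp [h, this]

theorem columnsEquiv_symm_single (k : ℤ) (v : Space) (z : ℤ) :
    (columnsEquiv.symm (lp.single 2 k v)).op (pos z) = if k = z then v else 0 := by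
  rw [columnsEquiv_symm_op_pos]
  split_ifs with h
  · subst h; simp
  · rw [lp.single_apply_ne _ _ _ (Ne.symm h)]

theorem hasSum_columns (ρ : HS) :
    HasSum (fun k : ℤ => columnsEquiv.symm (lp.single 2 k (ρ.op (pos k)))) ρ := by
  have h := (lp.hasSum_single (p := 2) (by norm_num) (columnsEquiv ρ)).map
    columnsEquiv.symm.toLinearEquiv columnsEquiv.symm.continuous
  rw [show columnsEquiv.symm.toLinearEquiv (columnsEquiv ρ) = ρ from
    columnsEquiv.symm_apply_apply ρ] at h
  exact h

/-- The `k`-th term keeps exactly the `k`-th column of `ρ`, so this is the expansion of a vector of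
`ℓ²(ℤ; ℓ²(ℤ))` in its coordinates. -/
theorem hasSum_rmulL_ketBra_self (ρ : HS) :
    HasSum (fun k : ℤ => rmulL (ketBra k k) ρ) ρ := by
  convert! hasSum_columns ρ using 2 with k
  refine ext_op_pos fun z => ?_
  rw [columnsEquiv_symm_single, rmulL_apply, op_rmul, mul_apply_eq_comp, ketBra_pos]
  split_ifs <;> simp

/-- The sum over rows is the adjoint of the sum over columns. -/
theorem hasSum_lmulL_ketBra_self (ρ : HS) :
    HasSum (fun k : ℤ => lmulL (ketBra k k) ρ) ρ := by
  have h := (hasSum_rmulL_ketBra_self (adj ρ)).map adjHom continuous_adj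
  rw [show adjHom (adj ρ) = ρ from adj_adj ρ] at h
  convert! h using 2 with k
  apply op_injective
  change ketBra k k * ρ.op = star (star ρ.op * ketBra k k)
  rw [star_mul, star_star, star_ketBra]

theorem lmulL_rmulL_ketBra_self (ρ : HS) (k : ℤ) :
    lmulL (ketBra k k) (rmulL (ketBra k k) ρ) = entry ρ.op k k • unit k k :=
  ext_op_pos fun z => by
    simp only [lmulL_apply, rmulL_apply, op_lmul, op_rmul, op_smul, op_unit, mul_apply_eq_comp,
      smul_apply, ketBra_pos]
    split_ifs with h
    · rw [ketBra_apply, entry_eq]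
    · simp

theorem hasSum_lmulL_rmulL_ketBra_self (ρ : HS) :
    HasSum (fun k : ℤ => lmulL (ketBra k k) (rmulL (ketBra k k) ρ)) (diag ρ) := by
  convert! hasSum_columns (diag ρ) using 2 with k
  refine ext_op_pos fun z => ?_
  rw [columnsEquiv_symm_single, diag_op_pos, lmulL_rmulL_ketBra_self, op_smul, smul_apply,
    op_unit, ketBra_pos]
  split_ifs <;> simp

/-- The only dependence on `k` sits in the projection `|e_k⟩⟨e_k|`. Pulling the fixed shifts out of
the sum reduces every site sum to the three model sums above. -/
theorem ketBra_eq (k a b : ℤ) :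
    ketBra (k + a) (k + b) = shiftL a * (ketBra k k * shiftL (-b)) := by
  rw [← mul_assoc, shiftL_mul_ketBra_mul_shiftL, sub_neg_eq_add]

theorem hasSum_lmulL_ketBra (a b : ℤ) (ρ : HS) :
    HasSum (fun k : ℤ => lmulL (ketBra (k + a) (k + b)) ρ) (lmulL (shiftL (a - b)) ρ) := by
  have h := (hasSum_lmulL_ketBra_self (lmulL (shiftL (-b)) ρ)).mapL (lmulL (shiftL a))
  simpa only [← lmulL_mul, ← ketBra_eq, shiftL_mul, ← sub_eq_add_neg] using h

theorem hasSum_rmulL_ketBra (a b : ℤ) (ρ : HS) :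
    HasSum (fun k : ℤ => rmulL (ketBra (k + a) (k + b)) ρ) (rmulL (shiftL (a - b)) ρ) := by
  have h := (hasSum_rmulL_ketBra_self (rmulL (shiftL a) ρ)).mapL (rmulL (shiftL (-b)))
  simpa only [← rmulL_mul, mul_assoc, ← ketBra_eq, shiftL_mul, ← sub_eq_add_neg] using h

/-- The operator `ρ ↦ ∑_k |e_{k+a}⟩⟨e_{k+b}| ρ |e_{k+d}⟩⟨e_{k+c}|`. -/
def transfer (a b c d : ℤ) : HS →L[ℂ] HS :=
  lmulL (shiftL a) ∘L rmulL (shiftL (-c)) ∘L diag ∘L lmulL (shiftL (-b)) ∘L rmulL (shiftL d)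

theorem transfer_apply (a b c d : ℤ) (ρ : HS) : transfer a b c d ρ =
    lmulL (shiftL a) (rmulL (shiftL (-c)) (diag (lmulL (shiftL (-b)) (rmulL (shiftL d) ρ)))) :=
  rfl

theorem hasSum_transfer (a b c d : ℤ) (ρ : HS) :
    HasSum (fun k : ℤ => lmulL (ketBra (k + a) (k + b)) (rmulL (ketBra (k + d) (k + c)) ρ))
      (transfer a b c d ρ) := by
  have h := ((hasSum_lmulL_rmulL_ketBra_self (lmulL (shiftL (-b)) (rmulL (shiftL d) ρ))).mapL
    (rmulL (shiftL (-c)))).mapL (lmulL (shiftL a))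
  rw [transfer_apply]
  convert! h using 2 with k
  rw [ketBra_eq, ketBra_eq]
  simp only [lmulL_mul, rmulL_mul, lmulL_rmulL]

/-- At most one site contributes, namely `k = x - b = y - d`. -/
theorem transfer_unit (a b c d x y : ℤ) : transfer a b c d (unit x y) =
    if x - b = y - d then unit (x - b + a) (y - d + c) else 0 := by
  rw [transfer_apply, rmulL_shiftL_unit, lmulL_shiftL_unit, diag_unit, ← sub_eq_add_neg]
  split_ifs
  · rw [rmulL_shiftL_unit, lmulL_shiftL_unit, sub_neg_eq_add]
  · simp only [map_zero]

end HS

/-! ### Fourier modes and the isomorphism. -/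

/-- The normalized character `q ↦ (2π)^{-1/2} e^{-iqx}`. -/
def mode (x : ℤ) (q : ℝ) : ℂ :=
  ((Real.sqrt (2 * Real.pi) : ℝ) : ℂ)⁻¹ * Complex.exp (-Complex.I * q * x)

theorem continuous_mode (x : ℤ) : Continuous (mode x) := by
  unfold mode; fun_prop

theorem norm_mode (x : ℤ) (q : ℝ) : ‖mode x q‖ = (Real.sqrt (2 * Real.pi))⁻¹ := by
  have : -Complex.I * q * x = ((-(q * x) : ℝ) : ℂ) * Complex.I := by push_cast; ring
  rw [mode, norm_mul, this, Complex.norm_exp_ofReal_mul_I, mul_one, norm_inv, Complex.norm_real,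
    Real.norm_of_nonneg (Real.sqrt_nonneg _)]

theorem conj_mode (x : ℤ) (q : ℝ) : star (mode x q) = mode (-x) q := by
  simp only [mode, star_mul', Complex.star_def, map_inv₀, Complex.conj_ofReal, ← Complex.exp_conj]
  congr 2
  simp

theorem mode_mul_mode (x y : ℤ) (q : ℝ) :
    mode x q * mode y q = ((2 * Real.pi : ℝ) : ℂ)⁻¹ * Complex.exp (-(x + y : ℤ) * Complex.I * q) := by
  have h : ((Real.sqrt (2 * Real.pi) : ℝ) : ℂ) * ((Real.sqrt (2 * Real.pi) : ℝ) : ℂ) =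
      ((2 * Real.pi : ℝ) : ℂ) := by
    rw [← Complex.ofReal_mul, Real.mul_self_sqrt (by positivity)]
  rw [mode, mode, mul_mul_mul_comm, ← mul_inv, h, ← Complex.exp_add]
  congr 2
  push_cast; ring

theorem integral_circleMeasure {E : Type*} [NormedAddCommGroup E] [NormedSpace ℝ E] (f : ℝ → E) :
    ∫ q, f q ∂circleMeasure = ∫ q in (0 : ℝ)..(2 * Real.pi), f q := by
  rw [circleMeasure, integral_Icc_eq_integral_Ioc,
    intervalIntegral.integral_of_le (by positivity)]

theorem integral_mode_mul_mode (x y : ℤ) :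
    ∫ q, star (mode x q) * mode y q ∂circleMeasure = if x = y then 1 else 0 := by
  simp only [conj_mode, mode_mul_mode]
  rw [integral_circleMeasure, intervalIntegral.integral_const_mul]
  split_ifs with h
  · have : (Real.pi : ℂ) ≠ 0 := by exact_mod_cast Real.pi_ne_zero
    subst h
    simp
    field_simp
  · have hc : (-((-x + y : ℤ) : ℂ) * Complex.I) ≠ 0 := by
      refine mul_ne_zero (neg_ne_zero.mpr ?_) Complex.I_ne_zero
      exact_mod_cast (by omega : (-x + y : ℤ) ≠ 0)
    rw [integral_exp_mul_complex hc]
    have : -((-x + y : ℤ) : ℂ) * Complex.I * ((2 * Real.pi : ℝ) : ℂ) =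
        ((-(-x + y) : ℤ) : ℂ) * (2 * Real.pi * Complex.I) := by push_cast; ring
    rw [this, Complex.exp_int_mul_two_pi_mul_I]
    simp

theorem memLp_mode_smul (x : ℤ) (v : Space) :
    MemLp (fun q => mode x q • v) 2 circleMeasure :=
  MemLp.of_bound ((continuous_mode x).smul continuous_const).aestronglyMeasurable
    ((Real.sqrt (2 * Real.pi))⁻¹ * ‖v‖) (ae_of_all _ fun q => by rw [norm_smul, norm_mode])

/-- The Fourier mode `q ↦ (2π)^{-1/2} e^{-iqx} e_{y-x}`. -/
def fourierMode (x y : ℤ) : DirectIntegral := (memLp_mode_smul x (pos (y - x))).toLp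

theorem coeFn_fourierMode (x y : ℤ) :
    fourierMode x y =ᵐ[circleMeasure] fun q => mode x q • pos (y - x) :=
  MemLp.coeFn_toLp _

theorem inner_fourierMode (x y : ℤ) (ψ : DirectIntegral) :
    inner ℂ (fourierMode x y) ψ = ∫ q, star (mode x q) * (ψ q : Space) (y - x) ∂circleMeasure := by
  rw [L2.inner_def]
  refine integral_congr_ae ((coeFn_fourierMode x y).mono fun q hq => ?_)
  simp only [hq, inner_smul_left, inner_pos_left, Complex.star_def]

theorem orthonormal_fourierMode : Orthonormal ℂ fun p : ℤ × ℤ => fourierMode p.1 p.2 := by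
  rw [orthonormal_iff_ite]
  rintro ⟨x, y⟩ ⟨x', y'⟩
  rw [inner_fourierMode]
  have h : ∫ q, star (mode x q) * (fourierMode x' y' q : Space) (y - x) ∂circleMeasure =
      ∫ q, star (mode x q) * mode x' q * (if y - x = y' - x' then 1 else 0) ∂circleMeasure := by
    refine integral_congr_ae ((coeFn_fourierMode x' y').mono fun q hq => ?_)
    simp only [hq, lp.coeFn_smul, Pi.smul_apply, pos_apply, smul_eq_mul, mul_assoc]
  rw [h, integral_mul_const, integral_mode_mul_mode]
  simp only [Prod.mk.injEq]
  by_cases hx : x = x'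
  · subst hx
    simp [sub_left_inj]
  · simp [hx]

theorem memLp_component (ψ : DirectIntegral) (n : ℤ) :
    MemLp (fun q => (ψ q : Space) n) 2 circleMeasure :=
  (lp.evalCLM ℂ (fun _ : ℤ => ℂ) 2 n).comp_memLp' (Lp.memLp ψ)

/-- Parseval on the circle: vanishing Fourier coefficients force the integral of `‖f‖ ^ 2` to
vanish. -/
theorem ae_eq_zero_of_fourier {f : ℝ → ℂ} (hf : MemLp f 2 circleMeasure)
    (h : ∀ x : ℤ, ∫ q, mode x q * f q ∂circleMeasure = 0) : f =ᵐ[circleMeasure] 0 := by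
  have hpi : (0 : ℝ) < 2 * Real.pi := by positivity
  have hf' : MemLp f 2 (volume.restrict (Set.Ioc 0 (2 * Real.pi))) := by
    rwa [circleMeasure, ← Measure.restrict_congr_set Ioc_ae_eq_Icc] at hf
  have hs := hasSum_sq_fourierCoeffOn hpi hf'
  have hz : ∀ i, fourierCoeffOn hpi f i = 0 := by
    intro i
    rw [fourierCoeffOn_eq_integral, ← integral_circleMeasure]
    -- The character `fourier (-i)` is `mode i` without its normalization.
    have hm : ∀ q : ℝ, fourier (-i) (q : AddCircle (2 * Real.pi - 0)) • f q =
        ((Real.sqrt (2 * Real.pi) : ℝ) : ℂ) * (mode i q * f q) := by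
      intro q
      have h0 : ((Real.sqrt (2 * Real.pi) : ℝ) : ℂ) ≠ 0 := by
        exact_mod_cast (Real.sqrt_pos.mpr hpi).ne'
      rw [fourier_coe_apply, mode, ← mul_assoc, mul_inv_cancel_left₀ h0, smul_eq_mul]
      congr 2
      have : (Real.pi : ℂ) ≠ 0 := by exact_mod_cast Real.pi_ne_zero
      push_cast
      field_simp
      ring
    simp only [hm]
    rw [integral_const_mul, h, mul_zero, smul_zero]
  simp only [hz, norm_zero, ne_eq, OfNat.ofNat_ne_zero, not_false_eq_true, zero_pow] at hs
  have h1 := hs.unique hasSum_zero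
  rw [smul_eq_zero, or_iff_right (by rw [sub_zero]; exact (inv_pos.mpr hpi).ne'),
    ← integral_circleMeasure] at h1
  rw [integral_eq_zero_iff_of_nonneg (fun q => by positivity)] at h1
  · filter_upwards [h1] with q hq
    simpa using hq
  · exact hf.integrable_norm_pow (by norm_num)

/-- The Fourier modes form a Hilbert basis. -/
def fourierModeBasis : HilbertBasis (ℤ × ℤ) ℂ DirectIntegral :=
  HilbertBasis.mkOfOrthogonalEqBot orthonormal_fourierMode <| by
    refine (Submodule.eq_bot_iff _).mpr fun ψ hψ => ?_
    -- The modes `fourierMode x (x + n)` with `n` fixed test only the `n`-th component of `ψ`. The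
    -- sign of `x` is flipped because the inner product conjugates the mode.
    have h : ∀ n : ℤ, ∀ᵐ q ∂circleMeasure, (ψ q : Space) n = 0 := fun n => by
      refine ae_eq_zero_of_fourier (memLp_component ψ n) fun x => ?_
      have := (Submodule.mem_orthogonal _ _).mp hψ (fourierMode (-x) (n - x))
        (Submodule.subset_span ⟨(-x, n - x), rfl⟩)
      rw [inner_fourierMode] at this
      simpa only [conj_mode, neg_neg, sub_neg_eq_add, sub_add_cancel] using this
    refine (Lp.eq_zero_iff_ae_eq_zero).mpr ((ae_all_iff.mpr h).mono fun q hq => ?_)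
    exact lp.ext (funext hq)

theorem fourierModeBasis_apply (p : ℤ × ℤ) : fourierModeBasis p = fourierMode p.1 p.2 := by
  simp [fourierModeBasis]

/-- The Fourier transform in the position at fixed relative coordinate. -/
def fourierIso : HS ≃ₗᵢ[ℂ] DirectIntegral :=
  HS.unitBasis.repr.trans fourierModeBasis.repr.symm

theorem fourierIso_unit (x y : ℤ) : fourierIso (HS.unit x y) = fourierMode x y := by
  rw [← HS.unitBasis_apply (x, y), fourierIso, LinearIsometryEquiv.trans_apply,
    HilbertBasis.repr_self, HilbertBasis.repr_symm_single, fourierModeBasis_apply]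

theorem isFourierIsomorphism_fourierIso : IsFourierIsomorphism fourierIso := fun x y => by
  rw [fourierIso_unit]
  exact coeFn_fourierMode x y

/-! ### Operators carried to direct integrals. -/

/-- The phase `e^{-iqs}`. -/
def phase (s : ℤ) (q : ℝ) : ℂ := Complex.exp (-Complex.I * q * s)

theorem continuous_phase (s : ℤ) : Continuous (phase s) := by
  unfold phase; fun_prop

theorem norm_phase (s : ℤ) (q : ℝ) : ‖phase s q‖ = 1 := by
  have : -Complex.I * q * s = ((-(q * s) : ℝ) : ℂ) * Complex.I := by push_cast; ring
  rw [phase, this, Complex.norm_exp_ofReal_mul_I]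

theorem phase_mul_mode (s x : ℤ) (q : ℝ) : phase s q * mode x q = mode (x + s) q := by
  rw [phase, mode, mode, mul_left_comm, ← Complex.exp_add]
  congr 2
  push_cast; ring

theorem memLp_phase_smul (s : ℤ) (ψ : DirectIntegral) :
    MemLp (fun q => phase s q • ψ q) 2 circleMeasure :=
  (Lp.memLp ψ).of_le ((continuous_phase s).aestronglyMeasurable.smul (Lp.aestronglyMeasurable ψ))
    (ae_of_all _ fun q => by rw [norm_smul, norm_phase, one_mul])

/-- Multiplication by the phase `e^{-iqs}` on the direct integral. -/
def phaseMul (s : ℤ) : DirectIntegral →L[ℂ] DirectIntegral :=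
  LinearMap.mkContinuous
    { toFun := fun ψ => (memLp_phase_smul s ψ).toLp
      map_add' := fun ψ φ => by
        rw [← MemLp.toLp_add]
        refine (MemLp.toLp_eq_toLp_iff _ _).mpr ((Lp.coeFn_add ψ φ).mono fun q hq => ?_)
        simp only [hq, Pi.add_apply, smul_add]
      map_smul' := fun c ψ => by
        rw [RingHom.id_apply, ← MemLp.toLp_const_smul]
        refine (MemLp.toLp_eq_toLp_iff _ _).mpr ((Lp.coeFn_smul c ψ).mono fun q hq => ?_)
        simp only [hq, Pi.smul_apply]
        rw [smul_comm] }
    1 fun ψ => by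
      rw [one_mul]
      refine Lp.norm_le_norm_of_ae_le ((MemLp.coeFn_toLp (memLp_phase_smul s ψ)).mono fun q hq => ?_)
      simp only [LinearMap.coe_mk, AddHom.coe_mk]
      rw [hq, norm_smul, norm_phase, one_mul]

theorem coeFn_phaseMul (s : ℤ) (ψ : DirectIntegral) :
    phaseMul s ψ =ᵐ[circleMeasure] fun q => phase s q • ψ q :=
  MemLp.coeFn_toLp (memLp_phase_smul s ψ)

theorem IsBoundedField.phase_smul (s : ℤ) (A : Space →L[ℂ] Space) :
    IsBoundedField fun q => phase s q • A where
  measurable v w := by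
    simp only [smul_apply, inner_smul_right]
    exact (continuous_phase s).measurable.mul_const _
  bounded := ⟨‖A‖, ae_of_all _ fun q => by rw [norm_smul, norm_phase, one_mul]⟩

theorem IsBoundedField.add {a b : ℝ → Space →L[ℂ] Space} (ha : IsBoundedField a)
    (hb : IsBoundedField b) : IsBoundedField fun q => a q + b q where
  measurable v w := by
    simp only [add_apply, inner_add_right]
    exact (ha.measurable v w).add (hb.measurable v w)
  bounded := by
    obtain ⟨C, hC⟩ := ha.bounded
    obtain ⟨D, hD⟩ := hb.bounded
    exact ⟨C + D, by filter_upwards [hC, hD] with q h1 h2 using norm_add_le_of_le h1 h2⟩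

theorem IsBoundedField.const_smul {a : ℝ → Space →L[ℂ] Space} (ha : IsBoundedField a) (c : ℂ) :
    IsBoundedField fun q => c • a q where
  measurable v w := by
    simp only [smul_apply, inner_smul_right]
    exact (ha.measurable v w).const_mul _
  bounded := by
    obtain ⟨C, hC⟩ := ha.bounded
    refine ⟨‖c‖ * C, hC.mono fun q h => ?_⟩
    rw [norm_smul]
    exact mul_le_mul_of_nonneg_left h (norm_nonneg c)

/-- `B` on `HS(ℓ²(ℤ))` is carried by the Fourier transform to the direct integral of `b`. -/
def Decomposes (B : HS →L[ℂ] HS) (b : ℝ → Space →L[ℂ] Space) : Prop :=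
  IsDirectIntegral (conjugate fourierIso B) b

theorem Decomposes.add {A B : HS →L[ℂ] HS} {a b : ℝ → Space →L[ℂ] Space} (hA : Decomposes A a)
    (hB : Decomposes B b) : Decomposes (A + B) fun q => a q + b q where
  field := hA.field.add hB.field
  apply_ae ψ := by
    have h : conjugate fourierIso (A + B) ψ =
        conjugate fourierIso A ψ + conjugate fourierIso B ψ := fourierIso.map_add _ _
    rw [h]
    filter_upwards [hA.apply_ae ψ, hB.apply_ae ψ,
      Lp.coeFn_add (conjugate fourierIso A ψ) (conjugate fourierIso B ψ)] with q h1 h2 h3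
    rw [h3, Pi.add_apply, h1, h2, add_apply]

theorem Decomposes.const_smul {A : HS →L[ℂ] HS} {a : ℝ → Space →L[ℂ] Space} (hA : Decomposes A a)
    (c : ℂ) : Decomposes (c • A) fun q => c • a q where
  field := hA.field.const_smul c
  apply_ae ψ := by
    have h : conjugate fourierIso (c • A) ψ = c • conjugate fourierIso A ψ :=
      fourierIso.map_smul _ _
    rw [h]
    filter_upwards [hA.apply_ae ψ, Lp.coeFn_smul c (conjugate fourierIso A ψ)] with q h1 h2
    rw [h2, Pi.smul_apply, h1, smul_apply]

/-- A bounded operator is determined by its values on the Fourier modes, whose span is dense. Fibres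
of the form phase times a constant operator suffice, since every fibre needed is a finite linear
combination of these. -/
theorem decomposes_of_unit {B : HS →L[ℂ] HS} {s : ℤ} {A : Space →L[ℂ] Space}
    (h : ∀ x y : ℤ, fourierIso (B (HS.unit x y)) =ᵐ[circleMeasure]
      fun q => phase s q • A (mode x q • pos (y - x))) :
    Decomposes B fun q => phase s q • A := by
  have key : conjugate fourierIso B = phaseMul s ∘L A.compLpL 2 circleMeasure := by
    refine ContinuousLinearMap.ext_on
      (s := Set.range fun p : ℤ × ℤ => fourierMode p.1 p.2) ?_ ?_
    · have hd := fourierModeBasis.dense_span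
      rw [funext fourierModeBasis_apply] at hd
      exact Submodule.dense_iff_topologicalClosure_eq_top.mpr hd
    · rintro _ ⟨⟨x, y⟩, rfl⟩
      have h1 : conjugate fourierIso B (fourierMode x y) = fourierIso (B (HS.unit x y)) := by
        rw [← fourierIso_unit]
        exact congrArg (fun ρ => fourierIso (B ρ)) (fourierIso.symm_apply_apply _)
      refine h1.trans (Lp.ext ?_)
      filter_upwards [h x y, coeFn_phaseMul s (A.compLpL 2 circleMeasure (fourierMode x y)),
        A.coeFn_compLpL (fourierMode x y), coeFn_fourierMode x y] with q h2 h3 h4 h5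
      rw [h2, ContinuousLinearMap.comp_apply, h3, h4, h5]
  refine ⟨IsBoundedField.phase_smul s A, fun ψ => ?_⟩
  rw [key]
  filter_upwards [coeFn_phaseMul s (A.compLpL 2 circleMeasure ψ), A.coeFn_compLpL ψ] with q h3 h4
  rw [ContinuousLinearMap.comp_apply, h3, h4, smul_apply]

theorem Decomposes.zero : Decomposes 0 fun _ => 0 := by
  have h : Decomposes 0 fun q => phase 0 q • (0 : Space →L[ℂ] Space) :=
    decomposes_of_unit fun x y => by
      rw [zero_apply, map_zero]
      filter_upwards [Lp.coeFn_zero Space 2 circleMeasure] with q hq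
      rw [hq, zero_apply, smul_zero, Pi.zero_apply]
  simpa only [smul_zero] using h

theorem Decomposes.sum {ι : Type*} (s : Finset ι) {A : ι → HS →L[ℂ] HS}
    {a : ι → ℝ → Space →L[ℂ] Space} (h : ∀ i, Decomposes (A i) (a i)) :
    Decomposes (∑ i ∈ s, A i) fun q => ∑ i ∈ s, a i q := by
  classical
  induction s using Finset.induction_on with
  | empty => simpa only [Finset.sum_empty] using Decomposes.zero
  | insert i s hi ih => simpa only [Finset.sum_insert hi] using (h i).add ih

theorem decomposes_lmulL_shiftL (s : ℤ) :
    Decomposes (HS.lmulL (shiftL s)) fun q => phase s q • shiftL (-s) :=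
  decomposes_of_unit fun x y => by
    rw [HS.lmulL_shiftL_unit, fourierIso_unit]
    filter_upwards [coeFn_fourierMode (x + s) y] with q hq
    rw [hq, map_smul, shiftL_pos, smul_smul, phase_mul_mode]
    congr 2; ring

/-- Right multiplication leaves `x` alone, so the phase is trivial; it is kept as `phase 0` to fit
`decomposes_of_unit`. -/
theorem decomposes_rmulL_shiftL (s : ℤ) :
    Decomposes (HS.rmulL (shiftL s)) fun q => phase 0 q • shiftL (-s) :=
  decomposes_of_unit fun x y => by
    rw [HS.rmulL_shiftL_unit, fourierIso_unit]
    filter_upwards [coeFn_fourierMode x (y - s)] with q hq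
    rw [hq, map_smul, shiftL_pos, smul_smul, phase_mul_mode, add_zero]
    congr 2; ring

/-- The condition for a nonzero image reads `y - x = d - b` and does not involve `x` separately.
This is the source of the finite rank of the jump fibre. -/
theorem decomposes_transfer (a b c d : ℤ) :
    Decomposes (HS.transfer a b c d) fun q => phase (a - b) q • ketBra (c - a) (d - b) :=
  decomposes_of_unit fun x y => by
    rw [HS.transfer_unit]
    by_cases h : x - b = y - d
    · rw [if_pos h, fourierIso_unit]
      filter_upwards [coeFn_fourierMode (x - b + a) (y - d + c)] with q hq
      rw [hq, map_smul, ketBra_pos, if_pos (by omega), smul_smul, phase_mul_mode,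
        show x - b + a = x + (a - b) by ring, show y - d + c - (x + (a - b)) = c - a by omega]
    · rw [if_neg h, map_zero]
      filter_upwards [Lp.coeFn_zero Space 2 circleMeasure] with q hq
      rw [hq, map_smul, ketBra_pos, if_neg (by omega), smul_zero, smul_zero, Pi.zero_apply]

/-! ### Band Laurent operators, local operators and covariant families. -/

/-- The bi-infinite Laurent operators of range at most `r`. -/
def laurentBand (r : ℕ) : Submodule ℂ (Space →L[ℂ] Space) where
  carrier := {A | IsLaurent A ∧ HasRange r A}
  zero_mem' := ⟨⟨0, fun x y => by simp [entry_eq]⟩, fun x y _ => by simp [entry_eq]⟩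
  add_mem' := by
    rintro A B ⟨⟨s, hs⟩, hA⟩ ⟨⟨t, ht⟩, hB⟩
    refine ⟨⟨s + t, fun x y => ?_⟩, fun x y h => ?_⟩
    · rw [entry_add, hs, ht, Pi.add_apply]
    · rw [entry_add, hA x y h, hB x y h, add_zero]
  smul_mem' := by
    rintro c A ⟨⟨s, hs⟩, hA⟩
    refine ⟨⟨c • s, fun x y => ?_⟩, fun x y h => ?_⟩
    · rw [entry_smul, hs, Pi.smul_apply, smul_eq_mul]
    · rw [entry_smul, hA x y h, mul_zero]

theorem shiftL_mem_laurentBand {r : ℕ} {s : ℤ} (hs : |s| ≤ r) : shiftL s ∈ laurentBand r := by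
  refine ⟨⟨fun n => if n = s then 1 else 0, fun x y => ?_⟩, fun x y h => ?_⟩
  · rw [entry_shiftL]
    simp only [sub_eq_iff_eq_add, add_comm]
  · rw [entry_shiftL, if_neg]
    rintro rfl
    rw [add_sub_cancel_left] at h
    omega

/-- The operators acting only on the sites at distance at most `r` from `k`. -/
def localOperators (k : ℤ) (r : ℕ) : Submodule ℂ (Space →L[ℂ] Space) where
  carrier := {A | IsLocalAt k r A}
  zero_mem' := fun x y _ => by simp [entry_eq]
  add_mem' := fun hA hB x y h => by rw [entry_add, hA x y h, hB x y h, add_zero]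
  smul_mem' := fun c A hA x y h => by rw [entry_smul, hA x y h, mul_zero]

theorem ketBra_mem_localOperators {k : ℤ} {r : ℕ} {a b : ℤ} (ha : |a - k| ≤ r) (hb : |b - k| ≤ r) :
    ketBra a b ∈ localOperators k r := fun x y h => by
  rw [entry_ketBra, if_neg]
  rintro ⟨rfl, rfl⟩
  omega

/-- The sites at distance at most `r` from the origin. -/
abbrev window (r : ℕ) : Finset ℤ := Finset.Icc (-(r : ℤ)) r

theorem mem_window {r : ℕ} {a : ℤ} : a ∈ window r ↔ |a| ≤ r := by
  rw [Finset.mem_Icc, abs_le]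

theorem IsLocalAt.eq_sum {k : ℤ} {r : ℕ} {A : Space →L[ℂ] Space} (h : IsLocalAt k r A) :
    A = ∑ p ∈ window r ×ˢ window r,
      entry A (k + p.1) (k + p.2) • ketBra (k + p.1) (k + p.2) :=
  ext_entry fun x y => by
    rw [entry_sum]
    simp only [entry_smul, entry_ketBra]
    rw [Finset.sum_eq_single (x - k, y - k)]
    · simp
    · rintro ⟨a, b⟩ - hne
      rw [if_neg, mul_zero]
      rintro ⟨rfl, rfl⟩
      simp at hne
    · intro hp
      have : (r : ℤ) < |x - k| ∨ (r : ℤ) < |y - k| := by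
        by_contra! hc
        exact hp (Finset.mem_product.mpr ⟨mem_window.mpr hc.1, mem_window.mpr hc.2⟩)
      simp [h x y this]

theorem IsLocalAt.isFiniteRank {k : ℤ} {r : ℕ} {A : Space →L[ℂ] Space} (h : IsLocalAt k r A) :
    IsFiniteRank A := by
  have hf : (pos '' (Set.Icc (k - r) (k + r))).Finite := (Set.finite_Icc _ _).image _
  have : FiniteDimensional ℂ (Submodule.span ℂ (pos '' (Set.Icc (k - r) (k + r)))) :=
    FiniteDimensional.span_of_finite ℂ hf
  refine Submodule.finiteDimensional_of_le
    (S₂ := Submodule.span ℂ (pos '' (Set.Icc (k - r) (k + r)))) ?_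
  rintro _ ⟨v, rfl⟩
  rw [h.eq_sum, ContinuousLinearMap.coe_coe, sum_apply]
  refine Submodule.sum_mem _ fun p hp => ?_
  rw [smul_apply, ketBra_apply]
  refine Submodule.smul_mem _ _ (Submodule.smul_mem _ _ (Submodule.subset_span ⟨_, ?_, rfl⟩))
  have := Finset.mem_Icc.mp (Finset.mem_product.mp hp).1
  constructor <;> omega

theorem IsLocalAt.hasRange {r : ℕ} {A : Space →L[ℂ] Space} (h : IsLocalAt 0 (2 * r) A) :
    HasRange (4 * r) A := fun x y hxy => h x y (by
  push_cast at hxy ⊢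
  rw [sub_zero, sub_zero]
  by_contra! hc
  have := abs_sub x y
  omega)

theorem conjShift_pos (A : Space →L[ℂ] Space) (y : ℤ) :
    conjShift A (pos y) = shift 1 (A (pos (y - 1))) := by
  change shift 1 (A (shift (-1) (pos y))) = _
  rw [shift_pos, sub_eq_add_neg]

theorem entry_conjShift (A : Space →L[ℂ] Space) (x y : ℤ) :
    entry (conjShift A) (x + 1) (y + 1) = entry A x y := by
  rw [entry_eq, conjShift_pos, shift_apply, entry_eq, add_sub_cancel_right, add_sub_cancel_right]

theorem entry_star_mul_self (A : Space →L[ℂ] Space) (x y : ℤ) :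
    entry (star A * A) x y = inner ℂ (A (pos x)) (A (pos y)) := by
  rw [entry, mul_apply_eq_comp, ContinuousLinearMap.star_eq_adjoint,
    ContinuousLinearMap.adjoint_inner_right]

theorem IsLocalAt.apply_pos_eq_zero {k : ℤ} {r : ℕ} {A : Space →L[ℂ] Space} (h : IsLocalAt k r A)
    {y : ℤ} (hy : (r : ℤ) < |y - k|) : A (pos y) = 0 :=
  lp.ext (funext fun x => (entry_eq A x y).symm.trans (h x y (Or.inr hy)))

theorem IsLocalAt.star_mul_self {k : ℤ} {r : ℕ} {A : Space →L[ℂ] Space} (h : IsLocalAt k r A) :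
    IsLocalAt k r (star A * A) := fun x y hxy => by
  rw [entry_star_mul_self]
  rcases hxy with hx | hy
  · rw [h.apply_pos_eq_zero hx, inner_zero_left]
  · rw [h.apply_pos_eq_zero hy, inner_zero_right]

theorem entry_translate {A : ℤ → Space →L[ℂ] Space}
    (h : ∀ k x y, entry (A (k + 1)) (x + 1) (y + 1) = entry (A k) x y) (k a b : ℤ) :
    entry (A k) (k + a) (k + b) = entry (A 0) a b := by
  induction k with
  | zero => rw [zero_add, zero_add]
  | succ n ih => rw [← ih, ← h n, add_right_comm _ 1 a, add_right_comm _ 1 b]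
  | pred n ih =>
    rw [← ih, ← h, sub_add_cancel, add_right_comm, sub_add_cancel, add_right_comm, sub_add_cancel]

/-- A family of operators, `A k` acting near the site `k`, that is translation covariant. -/
structure IsCovariantFamily (r : ℕ) (A : ℤ → Space →L[ℂ] Space) : Prop where
  isLocalAt : ∀ k, IsLocalAt k r (A k)
  translate : ∀ k x y, entry (A (k + 1)) (x + 1) (y + 1) = entry (A k) x y

theorem IsCovariantFamily.eq_sum {r : ℕ} {A : ℤ → Space →L[ℂ] Space} (h : IsCovariantFamily r A)
    (k : ℤ) : A k = ∑ p ∈ window r ×ˢ window r,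
      entry (A 0) p.1 p.2 • ketBra (k + p.1) (k + p.2) := by
  refine (h.isLocalAt k).eq_sum.trans (Finset.sum_congr rfl fun p _ => ?_)
  rw [entry_translate h.translate]

theorem IsCovariantFamily.star_mul_self {r : ℕ} {A : ℤ → Space →L[ℂ] Space}
    (hA : ∀ k, A (k + 1) = conjShift (A k)) (h : IsCovariantFamily r A) :
    IsCovariantFamily r fun k => star (A k) * A k where
  isLocalAt k := (h.isLocalAt k).star_mul_self
  translate k x y := by
    simp only [entry_star_mul_self]
    rw [hA, conjShift_pos, conjShift_pos, LinearIsometry.inner_map_map, add_sub_cancel_right,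
      add_sub_cancel_right]

/-- Translation invariance makes the entries depend on `x - y` only, and finite range leaves
finitely many diagonals, so `H` is a Laurent polynomial in the translation. -/
theorem HasRange.eq_sum {r : ℕ} {H : Space →L[ℂ] Space} (hr : HasRange r H)
    (ht : conjShift H = H) : H = ∑ s ∈ window r, entry H s 0 • shiftL s :=
  ext_entry fun x y => by
    have he : entry H x y = entry H (x - y) 0 := by
      have := entry_translate (A := fun _ => H)
        (fun _ x y => by conv_lhs => rw [← ht, entry_conjShift]) y (x - y) 0
      rwa [add_sub_cancel, add_zero] at this
    rw [entry_sum, he]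
    simp only [entry_smul, entry_shiftL]
    rw [Finset.sum_eq_single (x - y)]
    · simp
    · intro s _ hs
      rw [if_neg (by omega), mul_zero]
    · intro hs
      rw [mem_window, not_le] at hs
      rw [hr _ _ (by rwa [sub_zero]), zero_mul]

theorem hasSum_prod_of_fintype {ι κ E : Type*} [Fintype ι] [AddCommMonoid E] [TopologicalSpace E]
    [ContinuousAdd E] {f : ι × κ → E} {g : ι → E} (h : ∀ i, HasSum (fun k => f (i, k)) (g i)) :
    HasSum f (∑ i, g i) := by
  classical
  -- Each slice is extended by zero to the whole product, and the finitely many extensions are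
  -- added.
  have h1 : ∀ i, HasSum (fun p : ι × κ => if p.1 = i then f p else 0) (g i) := fun i => by
    rw [← (Prod.mk_right_injective i).hasSum_iff]
    · simpa [Function.comp_def] using h i
    · rintro ⟨i', k⟩ hp
      refine if_neg fun hi => hp ⟨k, ?_⟩
      rw [← hi]
  have h2 := hasSum_sum (s := Finset.univ) fun i _ => h1 i
  simpa using h2

/-! ### Jump, anticommutator and commutator parts of the generator. -/

theorem dissipator_eq (A : Space →L[ℂ] Space) (ρ : HS) :
    dissipator A ρ = HS.lmulL A (HS.rmulL (star A) ρ) -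
      (1 / 2 : ℂ) • (HS.lmulL (star A * A) ρ + HS.rmulL (star A * A) ρ) := by
  rw [HS.lmulL_rmulL]
  rfl

/-- The jump part `ρ ↦ ∑_k A_k ρ A_k*` of the generator of a covariant family. -/
def jumpPart (r : ℕ) (A : Space →L[ℂ] Space) : HS →L[ℂ] HS :=
  ∑ p ∈ window r ×ˢ window r, ∑ p' ∈ window r ×ˢ window r,
    (entry A p.1 p.2 * star (entry A p'.1 p'.2)) • HS.transfer p.1 p.2 p'.1 p'.2

/-- The fibre of the jump part. -/
def jumpFibre (r : ℕ) (A : Space →L[ℂ] Space) (q : ℝ) : Space →L[ℂ] Space :=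
  ∑ p ∈ window r ×ˢ window r, ∑ p' ∈ window r ×ˢ window r,
    (entry A p.1 p.2 * star (entry A p'.1 p'.2)) •
      phase (p.1 - p.2) q • ketBra (p'.1 - p.1) (p'.2 - p.2)

/-- The anticommutator part `ρ ↦ ∑_k (B_k ρ + ρ B_k)` of a covariant family. -/
def anticommutatorPart (r : ℕ) (B : Space →L[ℂ] Space) : HS →L[ℂ] HS :=
  ∑ p ∈ window r ×ˢ window r, entry B p.1 p.2 •
    (HS.lmulL (shiftL (p.1 - p.2)) + HS.rmulL (shiftL (p.1 - p.2)))

/-- The fibre of the anticommutator part. -/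
def anticommutatorFibre (r : ℕ) (B : Space →L[ℂ] Space) (q : ℝ) : Space →L[ℂ] Space :=
  ∑ p ∈ window r ×ˢ window r, entry B p.1 p.2 •
    (phase (p.1 - p.2) q • shiftL (-(p.1 - p.2)) + phase 0 q • shiftL (-(p.1 - p.2)))

/-- The fibre of the commutator with a translation-invariant operator of range `r`. -/
def commutatorFibre (r : ℕ) (H : Space →L[ℂ] Space) (q : ℝ) : Space →L[ℂ] Space :=
  ∑ s ∈ window r, entry H s 0 • (phase s q • shiftL (-s) + (-1 : ℂ) • phase 0 q • shiftL (-s))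

theorem decomposes_jumpPart (r : ℕ) (A : Space →L[ℂ] Space) :
    Decomposes (jumpPart r A) (jumpFibre r A) :=
  Decomposes.sum _ fun _ => Decomposes.sum _ fun _ => (decomposes_transfer _ _ _ _).const_smul _

theorem decomposes_anticommutatorPart (r : ℕ) (B : Space →L[ℂ] Space) :
    Decomposes (anticommutatorPart r B) (anticommutatorFibre r B) :=
  Decomposes.sum _ fun _ =>
    ((decomposes_lmulL_shiftL _).add (decomposes_rmulL_shiftL _)).const_smul _

theorem decomposes_commutator {r : ℕ} {H : Space →L[ℂ] Space} (hr : HasRange r H)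
    (ht : conjShift H = H) :
    Decomposes (HS.lmulL H + (-1 : ℂ) • HS.rmulL H) (commutatorFibre r H) := by
  have h : HS.lmulL H + (-1 : ℂ) • HS.rmulL H = ∑ s ∈ window r, entry H s 0 •
      (HS.lmulL (shiftL s) + (-1 : ℂ) • HS.rmulL (shiftL s)) := by
    have := congrArg (HS.lmulL + (-1 : ℂ) • HS.rmulL) (hr.eq_sum ht)
    simpa only [map_sum, map_smul, LinearMap.add_apply, LinearMap.smul_apply] using this
  rw [h]
  exact Decomposes.sum _ fun s =>
    ((decomposes_lmulL_shiftL s).add ((decomposes_rmulL_shiftL s).const_smul _)).const_smul _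

theorem jumpFibre_mem (r : ℕ) (A : Space →L[ℂ] Space) (q : ℝ) :
    jumpFibre r A q ∈ localOperators 0 (2 * r) :=
  Submodule.sum_mem _ fun p hp => Submodule.sum_mem _ fun p' hp' =>
    Submodule.smul_mem _ _ <| Submodule.smul_mem _ _ <| by
      simp only [Finset.mem_product, Finset.mem_Icc] at hp hp'
      apply ketBra_mem_localOperators <;> rw [sub_zero, abs_le] <;> push_cast <;> omega

/-- Both indices of an entry of `B` run over `[-r, r]`, so the shifts reach `2 * r`; this fixes the
band width of `T`, since the commutator needs only `r`. -/
theorem anticommutatorFibre_mem (r : ℕ) (B : Space →L[ℂ] Space) (q : ℝ) :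
    anticommutatorFibre r B q ∈ laurentBand (2 * r) :=
  Submodule.sum_mem _ fun p hp => by
    have hs : shiftL (-(p.1 - p.2)) ∈ laurentBand (2 * r) := by
      simp only [Finset.mem_product, Finset.mem_Icc] at hp
      apply shiftL_mem_laurentBand
      rw [abs_le]; push_cast; omega
    exact Submodule.smul_mem _ _ <|
      Submodule.add_mem _ (Submodule.smul_mem _ _ hs) (Submodule.smul_mem _ _ hs)

theorem commutatorFibre_mem (r : ℕ) (H : Space →L[ℂ] Space) (q : ℝ) :
    commutatorFibre r H q ∈ laurentBand (2 * r) :=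
  Submodule.sum_mem _ fun s hs => by
    have hs : shiftL (-s) ∈ laurentBand (2 * r) := by
      simp only [Finset.mem_Icc] at hs
      apply shiftL_mem_laurentBand
      rw [abs_le]; push_cast; omega
    exact Submodule.smul_mem _ _ <| Submodule.add_mem _ (Submodule.smul_mem _ _ hs)
      (Submodule.smul_mem _ _ (Submodule.smul_mem _ _ hs))

theorem IsCovariantFamily.hasSum_jumpPart {r : ℕ} {A : ℤ → Space →L[ℂ] Space}
    (h : IsCovariantFamily r A) (ρ : HS) :
    HasSum (fun k => HS.lmulL (A k) (HS.rmulL (star (A k)) ρ)) (jumpPart r (A 0) ρ) := by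
  have h1 : ∀ k, HS.lmulL (A k) (HS.rmulL (star (A k)) ρ) =
      ∑ p ∈ window r ×ˢ window r, ∑ p' ∈ window r ×ˢ window r,
        (entry (A 0) p.1 p.2 * star (entry (A 0) p'.1 p'.2)) •
          HS.lmulL (ketBra (k + p.1) (k + p.2)) (HS.rmulL (ketBra (k + p'.2) (k + p'.1)) ρ) := by
    intro k
    -- Both copies of `A k` are expanded; the star conjugates the coefficients and swaps ket and
    -- bra, hence the order `p'.2`, `p'.1`.
    conv_lhs => rw [h.eq_sum k]
    simp only [map_sum, map_smul, star_sum, star_smul, star_ketBra, sum_apply, smul_apply,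
      Finset.smul_sum, smul_smul]
    rw [Finset.sum_comm]
    simp only [mul_comm (star _)]
  simp only [h1, jumpPart, sum_apply, smul_apply]
  exact hasSum_sum fun p _ => hasSum_sum fun p' _ =>
    (HS.hasSum_transfer p.1 p.2 p'.1 p'.2 ρ).const_smul _

theorem IsCovariantFamily.hasSum_anticommutatorPart {r : ℕ} {B : ℤ → Space →L[ℂ] Space}
    (h : IsCovariantFamily r B) (ρ : HS) :
    HasSum (fun k => HS.lmulL (B k) ρ + HS.rmulL (B k) ρ) (anticommutatorPart r (B 0) ρ) := by
  have h1 : ∀ k, HS.lmulL (B k) ρ + HS.rmulL (B k) ρ =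
      ∑ p ∈ window r ×ˢ window r, entry (B 0) p.1 p.2 •
        (HS.lmulL (ketBra (k + p.1) (k + p.2)) ρ + HS.rmulL (ketBra (k + p.1) (k + p.2)) ρ) := by
    intro k
    conv_lhs => rw [h.eq_sum k]
    simp only [map_sum, map_smul, sum_apply, smul_apply, smul_add, Finset.sum_add_distrib]
  simp only [h1, anticommutatorPart, sum_apply, smul_apply, add_apply]
  exact hasSum_sum fun p _ =>
    ((HS.hasSum_lmulL_ketBra p.1 p.2 ρ).add (HS.hasSum_rmulL_ketBra p.1 p.2 ρ)).const_smul _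

theorem IsCovariantFamily.hasSum_dissipator {r : ℕ} {A : ℤ → Space →L[ℂ] Space}
    (h : IsCovariantFamily r A) (hA : ∀ k, A (k + 1) = conjShift (A k)) (ρ : HS) :
    HasSum (fun k => dissipator (A k) ρ)
      (jumpPart r (A 0) ρ - (1 / 2 : ℂ) • anticommutatorPart r (star (A 0) * A 0) ρ) := by
  simp only [dissipator_eq]
  exact (h.hasSum_jumpPart ρ).sub
    (((h.star_mul_self hA).hasSum_anticommutatorPart ρ).const_smul _)

end OpenQuantum

end

open OpenQuantum in
theorem mainTheorem10 :
    ∃ J : OpenQuantum.HS ≃ₗᵢ[ℂ] OpenQuantum.DirectIntegral,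
      OpenQuantum.IsFourierIsomorphism J ∧
      ∀ (R N : ℕ) (G : ℝ) (H : OpenQuantum.Space →L[ℂ] OpenQuantum.Space)
        (L : Fin N × ℤ → OpenQuantum.Space →L[ℂ] OpenQuantum.Space),
        0 < G → OpenQuantum.IsLocalTranslationInvariant R N H L →
        ∃ 𝓛 : OpenQuantum.HS →L[ℂ] OpenQuantum.HS,
          OpenQuantum.IsLindbladian H G L 𝓛 ∧
          ∃ T F : ℝ → OpenQuantum.Space →L[ℂ] OpenQuantum.Space,
            OpenQuantum.IsBoundedField T ∧ OpenQuantum.IsBoundedField F ∧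
            OpenQuantum.IsDirectIntegral (OpenQuantum.conjugate J 𝓛) (fun q => T q + F q) ∧
            ∀ q ∈ Set.Icc (0 : ℝ) (2 * Real.pi),
              (OpenQuantum.IsLaurent (T q) ∧ OpenQuantum.HasRange (2 * R) (T q)) ∧
              OpenQuantum.IsFiniteRank (F q) ∧ OpenQuantum.HasRange (4 * R) (F q) ∧
              OpenQuantum.IsLocalAt 0 (2 * R) (F q) := by
  refine ⟨fourierIso, isFourierIsomorphism_fourierIso, fun R N G H L _ h => ?_⟩
  have hcov : ∀ j, IsCovariantFamily R fun k => L (j, k) := fun j =>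
    ⟨h.lindblad_local j, fun k x y => by rw [h.lindblad_translation, entry_conjShift]⟩
  -- Everything built from one-sided multiplications goes into `T`, the two-sided jump terms into
  -- `F`.
  have hT := ((decomposes_commutator h.hamiltonian_range h.hamiltonian_translation).const_smul
    (-Complex.I)).add ((Decomposes.sum Finset.univ fun j =>
      (decomposes_anticommutatorPart R (star (L (j, 0)) * L (j, 0))).const_smul
        (-(1 / 2))).const_smul (G : ℂ))
  have hF := (Decomposes.sum Finset.univ fun j => decomposes_jumpPart R (L (j, 0))).const_smul
    (G : ℂ)
  -- The generator and the two fibre families are read off from `hT` and `hF` by unification.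
  refine ⟨_, fun ρ => ⟨_, hasSum_prod_of_fintype fun j =>
    (hcov j).hasSum_dissipator (h.lindblad_translation j) ρ, ?_⟩, _, _, hT.field, hF.field,
    hT.add hF, fun q _ => ⟨?_, ?_⟩⟩
  -- The generator was assembled as commutator, anticommutators, jumps; the terms are regrouped into
  -- Lindblad form.
  · simp only [add_apply, smul_apply, sum_apply, HS.lmulL_apply, HS.rmulL_apply,
      Finset.sum_sub_distrib, neg_smul, Finset.sum_neg_distrib, one_smul, ← sub_eq_add_neg,
      smul_sub, smul_neg]
    abel
  · exact Submodule.add_mem (laurentBand (2 * R))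
      (Submodule.smul_mem _ _ (commutatorFibre_mem R H q))
      (Submodule.smul_mem _ _ (Submodule.sum_mem _ fun j _ =>
        Submodule.smul_mem _ _ (anticommutatorFibre_mem R _ q)))
  · have hloc : IsLocalAt 0 (2 * R) ((G : ℂ) • ∑ j, jumpFibre R (L (j, 0)) q) :=
      Submodule.smul_mem (localOperators 0 (2 * R)) _
        (Submodule.sum_mem _ fun j _ => jumpFibre_mem R _ q)
    exact ⟨hloc.isFiniteRank, hloc.hasRange, hloc⟩
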